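/- **Proposition 2.2 (unitization of order zero maps).** Let $A$ and $B$ be $C^*$-algebras with $A$ nonunital, and let $\varphi : A \to B$ be a completely positive contractive (c.p.c.) map of order zero, i.e. for positive $a, b \in A$, $a \perp b$ implies $\varphi(a) \perp \varphi(b)$, where $x \perp y$ means $xy = yx = x^*y = xy^* = 0$. Let $C := C^*(\varphi(A)) \subset B$ be the $C^*$-subalgebra generated by the range of $\varphi$, let $C^{**}$ be its bidual, identified with its enveloping von Neumann algebra $\pi_u(C)''$ acting on the Hilbert space $H_u$ of the universal representation $\pi_u$ (the direct sum of the GNS representations of all states of $C$), and regard $C$ as embedded in $C^{**}$ via $\pi_u$. Let $A^+$ be the (one-point) unitization of $A$, with unit $\mathbf 1_{A^+}$. Then there is exactly one c.p.c. order zero map $\varphi^{(+)} : A^+ \to C^{**}$ that extends $\varphi$. Moreover, for every approximate unit $(u_\lambda)$ of $A$ consisting of positive elements of norm at most one (for instance, every increasing approximate unit), $$\varphi^{(+)}(\mathbf 1_{A^+}) = \lim_\lambda \varphi(u_\lambda)$$ in the strong operator topology on $H_u$. -/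

import Mathlib

open scoped ComplexOrder CStarAlgebra InnerProductSpace Topology

section Order

/-- A closed `*`-subalgebra of a C⋆-algebra, with the order inherited from the ambient algebra,
is an ordered C⋆-algebra: its positive elements are exactly the elements `y* y`. -/
theorem starOrderedRing_of_isClosed {A S : Type*} [NonUnitalCStarAlgebra A] [PartialOrder A]
    [StarOrderedRing A] [SetLike S A] [NonUnitalSubringClass S A] [SMulMemClass S ℂ A]
    [StarMemClass S A] (s : S) [IsClosed (s : Set A)] : StarOrderedRing s := by
  refine StarOrderedRing.of_nonneg_iff' (fun {x y} hxy z => ?_) fun x => ⟨fun hx => ?_, ?_⟩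
  · exact add_le_add_right (α := A) hxy _
  · have hx' : (0 : A) ≤ (x : A) := hx
    have hsa' : IsSelfAdjoint (x : A) := .of_nonneg hx'
    have hsa : IsSelfAdjoint x := Subtype.ext hsa'
    let φ : s →⋆ₙₐ[ℂ] A := NonUnitalStarSubalgebraClass.subtype s
    have hφ : Continuous φ := continuous_subtype_val
    have hc : ContinuousOn Real.sqrt (quasispectrum ℝ x) := Real.continuous_sqrt.continuousOn
    have hys : IsSelfAdjoint (cfcₙ Real.sqrt x) := cfcₙ_predicate _ x
    refine ⟨cfcₙ Real.sqrt x, ?_⟩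
    rw [hys.star_eq, ← cfcₙ_mul Real.sqrt Real.sqrt x hc (by simp) hc (by simp)]
    apply Subtype.ext
    change φ x = φ _
    have h0 : Continuous fun t : ℝ => √t * √t := by fun_prop
    rw [NonUnitalStarAlgHomClass.map_cfcₙ (S := ℂ) φ (fun t : ℝ => √t * √t) x
      h0.continuousOn (by simp) hφ hsa hsa']
    conv_lhs => rw [← cfcₙ_id ℝ (φ x) hsa']
    refine cfcₙ_congr fun t ht => ?_
    simp [Real.mul_self_sqrt (quasispectrum_nonneg_of_nonneg (φ x) hx' t ht)]
  · rintro ⟨y, rfl⟩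
    exact star_mul_self_nonneg (y : A)

end Order

section OrderZero

/-- Orthogonality of elements of a C⋆-algebra: `ab = ba = a*b = ab* = 0`. -/
def Orthogonal {A : Type*} [NonUnitalCStarAlgebra A] (a b : A) : Prop :=
  a * b = 0 ∧ b * a = 0 ∧ star a * b = 0 ∧ a * star b = 0

variable {A B : Type*} [NonUnitalCStarAlgebra A] [PartialOrder A] [StarOrderedRing A]
  [NonUnitalCStarAlgebra B] [PartialOrder B] [StarOrderedRing B]

/-- A completely positive map has order zero if it preserves orthogonality of positive elements. -/
def IsOrderZero (φ : A →CP B) : Prop :=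
  ∀ a b : A, 0 ≤ a → 0 ≤ b → Orthogonal a b → Orthogonal (φ a) (φ b)

/-- A map is contractive if `‖φ a‖ ≤ ‖a‖` for all `a`. -/
def IsContractive (φ : A →CP B) : Prop :=
  ∀ a : A, ‖φ a‖ ≤ ‖a‖

/-- The C⋆-subalgebra `C*(φ(A))` of `B` generated by the range of `φ`. -/
noncomputable def rangeCStar (φ : A →CP B) : NonUnitalStarSubalgebra ℂ B :=
  (NonUnitalStarAlgebra.adjoin ℂ (Set.range φ)).topologicalClosure

instance isClosed_rangeCStar (φ : A →CP B) : IsClosed (rangeCStar φ : Set B) :=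
  NonUnitalStarSubalgebra.isClosed_topologicalClosure _

instance starOrderedRing_rangeCStar (φ : A →CP B) : StarOrderedRing (rangeCStar φ) :=
  starOrderedRing_of_isClosed _

theorem map_mem_rangeCStar (φ : A →CP B) (a : A) : φ a ∈ rangeCStar φ :=
  NonUnitalStarSubalgebra.le_topologicalClosure _
    (NonUnitalStarAlgebra.subset_adjoin ℂ _ ⟨a, rfl⟩)

end OrderZero

section Bidual

variable (C : Type*) [NonUnitalCStarAlgebra C] [PartialOrder C] [StarOrderedRing C]

/-- The states of a C⋆-algebra: the positive linear functionals of norm one. -/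
def CStarState : Type _ :=
  {f : C →ₚ[ℂ] ℂ // ‖(⟨f.toLinearMap, map_continuous f⟩ : C →L[ℂ] ℂ)‖ = 1}

/-- The universal Hilbert space of `C`: the Hilbert space direct sum of the GNS spaces of all
states of `C`. -/
abbrev UniversalSpace : Type _ :=
  lp (fun f : CStarState C => f.1.GNS) 2

variable {C}

theorem norm_gns_le (f : CStarState C) (c : C) (x : f.1.GNS) :
    ‖f.1.gnsNonUnitalStarAlgHom c x‖ ≤ ‖c‖ * ‖x‖ :=
  (f.1.gnsNonUnitalStarAlgHom c).le_of_opNorm_le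
    (NonUnitalStarAlgHom.norm_apply_le f.1.gnsNonUnitalStarAlgHom c) x

theorem memℓp_gns (c : C) (ξ : UniversalSpace C) :
    Memℓp (fun f : CStarState C => f.1.gnsNonUnitalStarAlgHom c (ξ f)) 2 :=
  ((lp.memℓp ξ).norm.const_mul ‖c‖).mono fun f => norm_gns_le f c (ξ f)

/-- The operator `(ξ_f)_f ↦ (π_f(c) ξ_f)_f` on the universal Hilbert space, where `π_f` is the
GNS representation of the state `f`. -/
noncomputable def universalOp (c : C) : UniversalSpace C →L[ℂ] UniversalSpace C :=
  LinearMap.mkContinuous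
    { toFun := fun ξ => ⟨fun f => f.1.gnsNonUnitalStarAlgHom c (ξ f), memℓp_gns c ξ⟩
      map_add' := fun ξ η => by
        apply lp.ext
        funext f
        exact map_add (f.1.gnsNonUnitalStarAlgHom c) (ξ f) (η f)
      map_smul' := fun z ξ => by
        apply lp.ext
        funext f
        exact map_smul (f.1.gnsNonUnitalStarAlgHom c) z (ξ f) }
    ‖c‖ fun ξ => by
      have h : ‖((‖c‖ : ℂ) • ξ)‖ = ‖c‖ * ‖ξ‖ := by
        rw [norm_smul, Complex.norm_real, norm_norm]
      rw [← h]
      refine lp.norm_mono (by simp) fun f => ?_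
      have h' : ‖((‖c‖ : ℂ) • ξ : UniversalSpace C) f‖ = ‖c‖ * ‖ξ f‖ := by
        rw [lp.coeFn_smul, Pi.smul_apply, norm_smul, Complex.norm_real, norm_norm]
      rw [h']
      exact norm_gns_le f c (ξ f)

theorem universalOp_apply (c : C) (ξ : UniversalSpace C) (f : CStarState C) :
    universalOp c ξ f = f.1.gnsNonUnitalStarAlgHom c (ξ f) :=
  rfl

variable (C)

/-- The universal representation of `C`: the direct sum of the GNS representations of all states
of `C`. -/
noncomputable def universalRep :
    C →⋆ₙₐ[ℂ] (UniversalSpace C →L[ℂ] UniversalSpace C) where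
  toFun := universalOp
  map_smul' z c := by
    ext ξ f
    simp [universalOp_apply]
  map_zero' := by
    ext ξ f
    simp [universalOp_apply]
  map_add' c d := by
    ext ξ f
    simp [universalOp_apply]
  map_mul' c d := by
    ext ξ f
    simp [universalOp_apply]
  map_star' c := by
    refine (ContinuousLinearMap.eq_adjoint_iff _ _).mpr fun ξ η => ?_
    rw [lp.inner_eq_tsum, lp.inner_eq_tsum]
    refine tsum_congr fun f => ?_
    rw [universalOp_apply, universalOp_apply, map_star, ContinuousLinearMap.star_eq_adjoint,
      ContinuousLinearMap.adjoint_inner_left]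

theorem centralizer_doubleCentralizer {R : Type*} [Ring R] [StarRing R] [Algebra ℂ R]
    [StarModule ℂ R] (s : Set R) :
    Set.centralizer (Set.centralizer
      (StarSubalgebra.centralizer ℂ (StarSubalgebra.centralizer ℂ s : Set R) : Set R)) =
      (StarSubalgebra.centralizer ℂ (StarSubalgebra.centralizer ℂ s : Set R) : Set R) := by
  rw [StarSubalgebra.coe_centralizer_centralizer, Set.centralizer_centralizer_centralizer]

/-- The enveloping von Neumann algebra of `C`: the double commutant of the image of `C` under its
universal representation. -/
noncomputable def envelopingVonNeumannAlgebra : VonNeumannAlgebra (UniversalSpace C) where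
  toStarSubalgebra := StarSubalgebra.centralizer ℂ
    (StarSubalgebra.centralizer ℂ (Set.range (universalRep C)) :
      Set (UniversalSpace C →L[ℂ] UniversalSpace C))
  centralizer_centralizer' := centralizer_doubleCentralizer _

/-- The bidual `C**`, identified with the enveloping von Neumann algebra of `C`. -/
abbrev Bidual : Type _ :=
  (envelopingVonNeumannAlgebra C).toStarSubalgebra

instance isClosed_envelopingVonNeumannAlgebra :
    IsClosed ((envelopingVonNeumannAlgebra C).toStarSubalgebra :
      Set (UniversalSpace C →L[ℂ] UniversalSpace C)) :=
  Set.isClosed_centralizer _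

instance starOrderedRing_bidual : StarOrderedRing (Bidual C) :=
  starOrderedRing_of_isClosed _

theorem universalRep_mem (c : C) :
    universalRep C c ∈ (envelopingVonNeumannAlgebra C).toStarSubalgebra := by
  refine (StarSubalgebra.mem_centralizer_iff ℂ).mpr fun g hg => ?_
  have hg' := fun T hT => (StarSubalgebra.mem_centralizer_iff ℂ).mp hg T hT
  have h1 := (hg' _ ⟨c, rfl⟩).1
  have h2 := (hg' _ ⟨c, rfl⟩).2
  refine ⟨h1.symm, ?_⟩
  have h3 := congrArg star h2
  simpa using h3

/-- The canonical embedding of `C` into `C**`. -/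
noncomputable def toBidual (c : C) : Bidual C :=
  ⟨universalRep C c, universalRep_mem C c⟩

end Bidual

section Extension

variable {A B : Type*} [NonUnitalCStarAlgebra A] [PartialOrder A] [StarOrderedRing A]
  [NonUnitalCStarAlgebra B] [PartialOrder B] [StarOrderedRing B]

/-- `Φ : A⁺ → C**`, where `C = C*(φ(A))`, is a c.p.c. order zero map that extends `φ`. -/
structure IsOrderZeroExtension (φ : A →CP B)
    (Φ : Unitization ℂ A →CP Bidual (rangeCStar φ)) : Prop where
  contractive : IsContractive Φ
  orderZero : IsOrderZero Φ
  extends_map : ∀ a : A,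
    Φ (a : Unitization ℂ A) = toBidual (rangeCStar φ) ⟨φ a, map_mem_rangeCStar φ a⟩

end Extension

/-! If `f ≥ 0` has a selfadjoint local unit `e`, so `e f = f`, then for `u ≥ 0` the element `(1 - e)
u (1 - e)` is positive and orthogonal to `f`. Order zero then gives `φ(u) φ(f) = φ(eu + ue - eue)
φ(f)` (`IsOrderZero.mul_eq_of_localUnit`). Everything rests on this identity.

Existence: along an approximate unit the right side converges in norm to `φ(2e - e²) φ(f)`. Such `f`
span a dense subspace, `φ(A)` generates `C` as a closed right ideal, and the universal
representation is nondegenerate; with `‖φ(u)‖ ≤ 1` this makes `φ(u)` converge strongly to some `h`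
in the bicommutant. Put `Φ(z + a) = z h + φ(a)`. Since `A` is an ideal of `A⁺`, each `x` in `A⁺` is
approximated by elements of `A` (`x u`, `u x u`, or `c* u c` if `x = c* c`), and contractivity,
complete positivity and order zero pass to the strong limit.

Uniqueness: the identity with `u = 1` in `A⁺` reads `Φ(1) φ(f) = φ(2e - e²) φ(f)`, so `φ` determines
`Φ(1)` on `C`, hence on `H_u`. -/

open Filter

/-! ### Pointwise limits of bounded families of operators -/

section PointwiseLimits

variable {ι X Y : Type*} [NormedAddCommGroup X] [NormedSpace ℂ X] [NormedAddCommGroup Y]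
  [NormedSpace ℂ Y]

/-- The subspace of vectors on which a family of operators converges along a filter. -/
def convergenceSubmodule (F : ι → X →L[ℂ] Y) (l : Filter ι) : Submodule ℂ X where
  carrier := {x | ∃ y, Tendsto (fun i => F i x) l (𝓝 y)}
  add_mem' := by
    rintro x x' ⟨y, hy⟩ ⟨y', hy'⟩
    exact ⟨y + y', by simpa using hy.add hy'⟩
  zero_mem' := ⟨0, by simpa using tendsto_const_nhds⟩
  smul_mem' := by
    rintro c x ⟨y, hy⟩
    exact ⟨c • y, by simpa using hy.const_smul c⟩

theorem isClosed_convergenceSubmodule [CompleteSpace Y] {F : ι → X →L[ℂ] Y} {l : Filter ι}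
    [l.NeBot] {K : ℝ} (hF : ∀ᶠ i in l, ‖F i‖ ≤ K) :
    IsClosed (convergenceSubmodule F l : Set X) := by
  refine isClosed_of_closure_subset fun x hx => ?_
  suffices h : Cauchy (map (fun i => F i x) l) from CompleteSpace.complete h
  refine Metric.cauchy_iff.mpr ⟨inferInstance, fun ε hε => ?_⟩
  have hK : 0 ≤ K := by
    obtain ⟨i, hi⟩ := hF.exists
    exact (norm_nonneg _).trans hi
  -- The denominator uses `K + 1` because `K` may be zero.
  obtain ⟨x', ⟨y, hy⟩, hxx'⟩ := Metric.mem_closure_iff.mp hx (ε / (4 * (K + 1))) (by positivity)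
  have hclose : ∀ᶠ i in l, dist (F i x) y < ε / 2 := by
    filter_upwards [hF, Metric.tendsto_nhds.mp hy (ε / 4) (by positivity)] with i hi hi'
    have h1 : dist (F i x) (F i x') ≤ K * dist x x' := by
      rw [dist_eq_norm, dist_eq_norm, ← map_sub]
      exact (F i).le_of_opNorm_le hi _
    have h2 : K * dist x x' ≤ (K + 1) * (ε / (4 * (K + 1))) := by
      gcongr
      linarith
    have h3 : (K + 1) * (ε / (4 * (K + 1))) = ε / 4 := by field_simp
    linarith [dist_triangle (F i x) (F i x') y]
  refine ⟨Metric.ball y (ε / 2), hclose, fun a ha b hb => ?_⟩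
  linarith [dist_triangle_right a b y, Metric.mem_ball.mp ha, Metric.mem_ball.mp hb]

/-- The pointwise limit of an eventually bounded, pointwise convergent family of operators. -/
theorem exists_clm_of_tendsto {F : ι → X →L[ℂ] Y} {l : Filter ι} [l.NeBot] {K : ℝ}
    (hF : ∀ᶠ i in l, ‖F i‖ ≤ K) (h : ∀ x, ∃ y, Tendsto (fun i => F i x) l (𝓝 y)) :
    ∃ T : X →L[ℂ] Y, ∀ x, Tendsto (fun i => F i x) l (𝓝 (T x)) := by
  choose T hT using h
  refine ⟨LinearMap.mkContinuous
    { toFun := T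
      map_add' := fun x y => tendsto_nhds_unique (hT (x + y)) (by simpa using (hT x).add (hT y))
      map_smul' := fun c x => tendsto_nhds_unique (hT (c • x))
        (by simpa using (hT x).const_smul c) } K fun x => ?_, hT⟩
  refine le_of_tendsto (hT x).norm ?_
  filter_upwards [hF] with i hi using (F i).le_of_opNorm_le hi x

end PointwiseLimits

/-! ### Approximate units and elements with local units -/

section ApproximateUnits

variable {A : Type*} [NonUnitalCStarAlgebra A] [PartialOrder A]

/-- A limit along the join is a limit along both filters; this makes strong limits independent of
the approximate unit. -/
theorem Filter.IsIncreasingApproximateUnit.sup {l l' : Filter A}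
    (hl : l.IsIncreasingApproximateUnit) (hl' : l'.IsIncreasingApproximateUnit) :
    (l ⊔ l').IsIncreasingApproximateUnit where
  tendsto_mul_left m := tendsto_sup.mpr ⟨hl.tendsto_mul_left m, hl'.tendsto_mul_left m⟩
  tendsto_mul_right m := tendsto_sup.mpr ⟨hl.tendsto_mul_right m, hl'.tendsto_mul_right m⟩
  neBot := hl.neBot.mono le_sup_left
  eventually_nonneg := eventually_sup.mpr ⟨hl.eventually_nonneg, hl'.eventually_nonneg⟩
  eventually_norm := eventually_sup.mpr ⟨hl.eventually_norm, hl'.eventually_norm⟩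

theorem Filter.IsIncreasingApproximateUnit.tendsto_mul_mul {l : Filter A}
    (hl : l.IsIncreasingApproximateUnit) {F : A → A} {a : A} (hF : Tendsto F l (𝓝 a)) :
    Tendsto (fun u => u * F u) l (𝓝 a) := by
  have h1 : Tendsto (fun u => u * (F u - a)) l (𝓝 0) := by
    rw [tendsto_zero_iff_norm_tendsto_zero]
    refine squeeze_zero' (Eventually.of_forall fun _ => norm_nonneg _) ?_
      (tendsto_iff_norm_sub_tendsto_zero.mp hF)
    filter_upwards [hl.eventually_norm] with u hu
    calc ‖u * (F u - a)‖ ≤ ‖u‖ * ‖F u - a‖ := norm_mul_le _ _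
      _ ≤ 1 * ‖F u - a‖ := by gcongr
      _ = _ := one_mul _
  simpa [mul_sub] using h1.add (hl.tendsto_mul_right a)

theorem Filter.IsIncreasingApproximateUnit.tendsto_mul_mul' {l : Filter A}
    (hl : l.IsIncreasingApproximateUnit) {F : A → A} {a : A} (hF : Tendsto F l (𝓝 a)) :
    Tendsto (fun u => F u * u) l (𝓝 a) := by
  have h1 : Tendsto (fun u => (F u - a) * u) l (𝓝 0) := by
    rw [tendsto_zero_iff_norm_tendsto_zero]
    refine squeeze_zero' (Eventually.of_forall fun _ => norm_nonneg _) ?_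
      (tendsto_iff_norm_sub_tendsto_zero.mp hF)
    filter_upwards [hl.eventually_norm] with u hu
    calc ‖(F u - a) * u‖ ≤ ‖F u - a‖ * ‖u‖ := norm_mul_le _ _
      _ ≤ ‖F u - a‖ * 1 := by gcongr
      _ = _ := mul_one _
  simpa [sub_mul] using h1.add (hl.tendsto_mul_left a)

variable [StarOrderedRing A]

/-- Needed because the compression `u (z + a) u` has leading term `z u²`. -/
theorem Filter.IsIncreasingApproximateUnit.map_mul_self {l : Filter A}
    (hl : l.IsIncreasingApproximateUnit) :
    (l.map fun u => u * u).IsIncreasingApproximateUnit where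
  tendsto_mul_left m := by
    refine tendsto_map'_iff.mpr ?_
    simpa [Function.comp_def, mul_assoc] using hl.tendsto_mul_mul' (hl.tendsto_mul_left m)
  tendsto_mul_right m := by
    refine tendsto_map'_iff.mpr ?_
    simpa [Function.comp_def, mul_assoc] using hl.tendsto_mul_mul (hl.tendsto_mul_right m)
  neBot := hl.neBot.map _
  eventually_nonneg := by
    refine eventually_map.mpr ?_
    filter_upwards [hl.eventually_nonneg] with u hu
    simpa [(IsSelfAdjoint.of_nonneg hu).star_eq] using star_mul_self_nonneg u
  eventually_norm := by
    refine eventually_map.mpr ?_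
    filter_upwards [hl.eventually_norm] with u hu
    exact (norm_mul_le _ _).trans (mul_le_one₀ hu (norm_nonneg _) hu)

/-- Every positive element is a norm limit of positive elements that have a local unit. -/
theorem exists_nonneg_localUnit {a : A} (ha : 0 ≤ a) {ε : ℝ} (hε : 0 < ε) :
    ∃ f e : A, 0 ≤ f ∧ IsSelfAdjoint e ∧ e * f = f ∧ ‖a - f‖ ≤ ε := by
  -- `(t - ε)₊` lives on `t ≥ ε`, where the cutoff `min (t / ε) 1` equals one. Both functions vanish
  -- at zero, as the nonunital calculus requires.
  have hc : Continuous fun t : ℝ => max (t - ε) 0 := by fun_prop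
  have hd : Continuous fun t : ℝ => max (min (t / ε) 1) 0 := by fun_prop
  refine ⟨cfcₙ (fun t : ℝ => max (t - ε) 0) a, cfcₙ (fun t : ℝ => max (min (t / ε) 1) 0) a,
    cfcₙ_nonneg fun t _ => le_max_right _ _, cfcₙ_predicate _ a, ?_, ?_⟩
  · rw [← cfcₙ_mul _ _ a hd.continuousOn (by simp) hc.continuousOn (by simp [hε.le])]
    refine cfcₙ_congr fun t _ => ?_
    rcases le_total t ε with h | h
    · simp [h]
    · have : 1 ≤ t / ε := (one_le_div hε).mpr h
      simp [this]
  · nth_rewrite 1 [← cfcₙ_id ℝ a (.of_nonneg ha)]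
    rw [← cfcₙ_sub _ _ a continuousOn_id (by simp) hc.continuousOn (by simp [hε.le])]
    refine norm_cfcₙ_le fun t ht => ?_
    have ht0 : 0 ≤ t := quasispectrum_nonneg_of_nonneg a ha t ht
    rw [Real.norm_eq_abs, abs_le]
    simp only [id]
    rcases le_total t ε with h | h
    · rw [max_eq_right (by linarith)]
      constructor <;> linarith
    · rw [max_eq_left (by linarith)]
      constructor <;> linarith

/-- A closed subspace that contains every positive element with a local unit is everything. -/
theorem submodule_eq_top_of_localUnit {S : Submodule ℂ A} (hS : IsClosed (S : Set A))
    (h : ∀ f e : A, 0 ≤ f → IsSelfAdjoint e → e * f = f → f ∈ S) : S = ⊤ := by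
  rw [eq_top_iff, ← CStarAlgebra.span_nonneg, Submodule.span_le]
  intro a ha
  rw [← hS.closure_eq, Metric.mem_closure_iff]
  intro ε hε
  obtain ⟨f, e, hf, he, hef, hd⟩ := exists_nonneg_localUnit ha (half_pos hε)
  exact ⟨f, h f e hf he hef, by rw [dist_eq_norm]; linarith⟩

end ApproximateUnits

/-! ### Positivity of matrices over a C⋆-algebra -/

section MatrixPositivity

theorem exists_eq_star_mul_self {E : Type*} [NonUnitalCStarAlgebra E] [PartialOrder E]
    [StarOrderedRing E] {x : E} (hx : 0 ≤ x) : ∃ y, x = star y * y :=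
  CStarAlgebra.nonneg_iff_eq_star_mul_self.mp hx

/-- A selfadjoint element is positive if its compression by its negative part forces the latter
to vanish. -/
theorem nonneg_of_forall_conj {E : Type*} [NonUnitalCStarAlgebra E] [PartialOrder E]
    [StarOrderedRing E] {x : E} (hx : IsSelfAdjoint x)
    (h : ∀ p s : E, star p = p → star (s * p) * (s * p) = -(star p * x * p) → s * p = 0) :
    0 ≤ x := by
  rw [← CFC.negPart_eq_zero_iff x hx]
  set p := x⁻ with hp
  have hpn : 0 ≤ p := CFC.negPart_nonneg x
  have hps : star p = p := (IsSelfAdjoint.of_nonneg hpn).star_eq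
  obtain ⟨s, hs⟩ := exists_eq_star_mul_self hpn
  have hpxp : p * x * p = -(p * p * p) := by
    nth_rewrite 1 [← CFC.posPart_sub_negPart x hx]
    rw [mul_sub, CFC.negPart_mul_posPart, zero_sub, neg_mul]
  -- With `p = s* s` one has `(s p)* (s p) = p³ = -p x p`. Once `s p = 0`, also `p² = s* (s p) = 0`.
  have hX : s * p = 0 := by
    refine h p s hps ?_
    rw [hps, hpxp, neg_neg, star_mul, hps, mul_assoc, ← mul_assoc (star s), ← hs, mul_assoc]
  have hpp : star p * p = 0 := by
    rw [hps]
    nth_rewrite 1 [hs]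
    rw [mul_assoc, hX, mul_zero]
  exact CStarRing.star_mul_self_eq_zero_iff _ |>.mp hpp

variable {n D : Type*} [Fintype n] [NonUnitalCStarAlgebra D] [PartialOrder D] [StarOrderedRing D]

/-- Writing `N = S* S`, the sum is `∑ₖ (S v)ₖ* (S v)ₖ`. -/
theorem CStarMatrix.sum_conj_nonneg {N : CStarMatrix n n D} (hN : 0 ≤ N) (v : n → D) :
    0 ≤ ∑ i, ∑ j, star (v i) * N i j * v j := by
  obtain ⟨S, rfl⟩ := exists_eq_star_mul_self hN
  have h : ∑ i, ∑ j, star (v i) * (star S * S) i j * v j =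
      ∑ k, star (∑ i, S k i * v i) * (∑ j, S k j * v j) := by
    simp only [CStarMatrix.mul_apply, CStarMatrix.star_apply, star_sum, star_mul,
      Finset.mul_sum, Finset.sum_mul]
    rw [Finset.sum_comm_cycle]
    refine Finset.sum_congr rfl fun k _ => ?_
    rw [Finset.sum_comm]
    refine Finset.sum_congr rfl fun i _ => Finset.sum_congr rfl fun j _ => ?_
    simp only [mul_assoc]
  rw [h]
  exact Finset.sum_nonneg fun k _ => star_mul_self_nonneg _

theorem CStarMatrix.eq_zero_of_star_mul_self_diag_nonpos {X : CStarMatrix n n D}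
    (h : ∀ k, (star X * X) k k ≤ 0) : X = 0 := by
  refine CStarMatrix.ext fun i k => ?_
  have h1 : (star X * X) k k = ∑ i, star (X i k) * X i k := by
    simp [CStarMatrix.mul_apply, CStarMatrix.star_apply]
  have h2 : star (X i k) * X i k ≤ 0 :=
    (Finset.single_le_sum (f := fun i => star (X i k) * X i k)
      (fun i _ => star_mul_self_nonneg _) (Finset.mem_univ i)).trans (h1 ▸ h k)
  have h3 : star (X i k) * X i k = 0 := le_antisymm h2 (star_mul_self_nonneg _)
  exact CStarRing.star_mul_self_eq_zero_iff _ |>.mp h3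

/-- The columns of the negative part `P` of `N` serve as test vectors: they make the diagonal of `P*
N P` positive, while `P* N P = -(S P)* (S P)`. The criterion reduces matrix positivity to single
elements, which behave well under subalgebras and strong limits. -/
theorem CStarMatrix.nonneg_of_sum_conj_nonneg {N : CStarMatrix n n D} (hN : IsSelfAdjoint N)
    (h : ∀ v : n → D, 0 ≤ ∑ i, ∑ j, star (v i) * N i j * v j) : 0 ≤ N := by
  refine nonneg_of_forall_conj hN fun P S hP hS =>
    CStarMatrix.eq_zero_of_star_mul_self_diag_nonpos fun k => ?_
  have h2 : (star P * N * P) k k = ∑ i, ∑ j, star (P i k) * N i j * P j k := by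
    simp only [CStarMatrix.mul_apply, CStarMatrix.star_apply, Finset.sum_mul]
    exact Finset.sum_comm
  rw [hS, CStarMatrix.neg_apply, h2]
  exact neg_nonpos.mpr (h fun i => P i k)

end MatrixPositivity

/-! ### Order zero maps: norm convergence of `φ(u) c` -/

section OrderZeroMaps

variable {A B : Type*} [NonUnitalCStarAlgebra A] [PartialOrder A] [StarOrderedRing A]
  [NonUnitalCStarAlgebra B] [PartialOrder B] [StarOrderedRing B]

/-- A contractive completely positive map as a continuous linear map. -/
noncomputable def IsContractive.toCLM {φ : A →CP B} (hφ : IsContractive φ) : A →L[ℂ] B :=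
  (φ : A →ₗ[ℂ] B).mkContinuous 1 fun a => by simpa using hφ a

theorem IsContractive.continuous {φ : A →CP B} (hφ : IsContractive φ) : Continuous φ :=
  hφ.toCLM.continuous

/-- If `e` is a local unit for `f`, then `φ u * φ f` only depends on `e u + u e - e u e`. -/
theorem IsOrderZero.mul_eq_of_localUnit {φ : A →CP B} (hφ : IsOrderZero φ) {u e f : A}
    (hu : 0 ≤ u) (hf : 0 ≤ f) (he : IsSelfAdjoint e) (hef : e * f = f) :
    φ u * φ f = φ (e * u + u * e - e * u * e) * φ f := by
  obtain ⟨v, hv⟩ := CStarAlgebra.nonneg_iff_eq_star_mul_self.mp hu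
  -- In the unitization this is `(1 - e) u (1 - e)`, with `v - v e = v (1 - e)`.
  have hw : u - (e * u + u * e - e * u * e) = star (v - v * e) * (v - v * e) := by
    rw [hv]
    simp only [star_sub, star_mul, he.star_eq]
    noncomm_ring
  have hp : 0 ≤ u - (e * u + u * e - e * u * e) := hw ▸ star_mul_self_nonneg _
  have hps : star (u - (e * u + u * e - e * u * e)) = u - (e * u + u * e - e * u * e) :=
    (IsSelfAdjoint.of_nonneg hp).star_eq
  have hfs : star f = f := (IsSelfAdjoint.of_nonneg hf).star_eq
  have hpf : (u - (e * u + u * e - e * u * e)) * f = 0 := by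
    simp only [sub_mul, add_mul, mul_assoc, hef]
    abel
  have hfp : f * (u - (e * u + u * e - e * u * e)) = 0 := by
    have := congrArg star hpf
    rwa [star_mul, hps, hfs, star_zero] at this
  have h := (hφ _ _ hp hf ⟨hpf, hfp, hps.symm ▸ hpf, hfs.symm ▸ hpf⟩).1
  rw [map_sub, sub_mul, sub_eq_zero] at h
  exact h

/-- On elements with a local unit, `φ(u)` may be replaced by `φ(eu + ue - eue)`, whose argument
converges in norm. Density and the uniform bound do the rest. -/
theorem IsOrderZero.exists_tendsto_mul {φ : A →CP B} (hφ : IsContractive φ) (hφ₀ : IsOrderZero φ)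
    {l : Filter A} (hl : l.IsIncreasingApproximateUnit) (a : A) :
    ∃ y, Tendsto (fun u => φ u * φ a) l (𝓝 y) := by
  have := hl.neBot
  let F : A → A →L[ℂ] B := fun u => (ContinuousLinearMap.mul ℂ B (φ u)).comp hφ.toCLM
  have hF : ∀ᶠ u in l, ‖F u‖ ≤ 1 := by
    filter_upwards [hl.eventually_norm] with u hu
    refine ContinuousLinearMap.opNorm_le_bound _ zero_le_one fun a => ?_
    calc ‖φ u * φ a‖ ≤ ‖φ u‖ * ‖φ a‖ := norm_mul_le _ _
      _ ≤ 1 * ‖a‖ := by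
        gcongr
        · exact (hφ u).trans hu
        · exact hφ a
  have h : convergenceSubmodule F l = ⊤ := by
    refine submodule_eq_top_of_localUnit (isClosed_convergenceSubmodule hF)
      fun f e hf he hef => ⟨φ (e + e - e * e) * φ f, ?_⟩
    have h1 : Tendsto (fun u => e * u + u * e - e * u * e) l (𝓝 (e + e - e * e)) :=
      ((hl.tendsto_mul_left e).add (hl.tendsto_mul_right e)).sub
        ((hl.tendsto_mul_left e).mul_const e)
    refine (((hφ.continuous.tendsto _).comp h1).mul_const (φ f)).congr' ?_
    filter_upwards [hl.eventually_nonneg] with u hu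
    exact (hφ₀.mul_eq_of_localUnit hu hf he hef).symm
  exact (h ▸ Submodule.mem_top : a ∈ convergenceSubmodule F l)

/-- The range of `φ` generates its codomain as a closed right ideal. -/
def GeneratesRightIdeal (φ : A →CP B) : Prop :=
  ∀ S : Submodule ℂ B, IsClosed (S : Set B) → (∀ x ∈ S, ∀ y, x * y ∈ S) → (∀ a, φ a ∈ S) → S = ⊤

/-- The `b` for which `φ(u) b` converges form a closed right ideal containing `φ(A)`. -/
theorem IsOrderZero.exists_tendsto_mul_of_generates {φ : A →CP B} (hφ : IsContractive φ)
    (hφ₀ : IsOrderZero φ) (hg : GeneratesRightIdeal φ) {l : Filter A}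
    (hl : l.IsIncreasingApproximateUnit) (b : B) :
    ∃ y, Tendsto (fun u => φ u * b) l (𝓝 y) := by
  have := hl.neBot
  let F : A → B →L[ℂ] B := fun u => ContinuousLinearMap.mul ℂ B (φ u)
  have hF : ∀ᶠ u in l, ‖F u‖ ≤ 1 := by
    filter_upwards [hl.eventually_norm] with u hu
    exact (ContinuousLinearMap.opNorm_mul_apply_le ℂ B (φ u)).trans ((hφ u).trans hu)
  have h : convergenceSubmodule F l = ⊤ := by
    refine hg _ (isClosed_convergenceSubmodule hF) ?_ fun a => hφ₀.exists_tendsto_mul hφ hl a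
    rintro x ⟨y, hy⟩ z
    exact ⟨y * z, by simpa [F, mul_assoc] using hy.mul_const z⟩
  exact (h ▸ Submodule.mem_top : b ∈ convergenceSubmodule F l)

/-- The corestriction of `φ` to the C⋆-algebra generated by its range. -/
noncomputable def rangeRestrict (φ : A →CP B) : A →CP rangeCStar φ where
  toFun a := ⟨φ a, map_mem_rangeCStar φ a⟩
  map_add' a b := Subtype.ext (map_add φ a b)
  map_smul' z a := Subtype.ext (map_smul φ z a)
  map_cstarMatrix_nonneg' k M hM := by
    have hN : 0 ≤ M.map φ := φ.map_cstarMatrix_nonneg M hM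
    refine CStarMatrix.nonneg_of_sum_conj_nonneg ?_ fun v => ?_
    · refine CStarMatrix.ext fun i j => Subtype.ext ?_
      exact CStarMatrix.ext_iff.mpr (IsSelfAdjoint.of_nonneg hN).star_eq i j
    · have h := CStarMatrix.sum_conj_nonneg hN fun i => (v i : B)
      change (0 : B) ≤ ((∑ i, ∑ j, _ : rangeCStar φ) : B)
      simpa using h

theorem IsContractive.rangeRestrict {φ : A →CP B} (hφ : IsContractive φ) :
    IsContractive (rangeRestrict φ) :=
  hφ

theorem IsOrderZero.rangeRestrict {φ : A →CP B} (hφ : IsOrderZero φ) :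
    IsOrderZero (rangeRestrict φ) := fun a b ha hb hab =>
  have h := hφ a b ha hb hab
  ⟨Subtype.ext h.1, Subtype.ext h.2.1, Subtype.ext h.2.2.1, Subtype.ext h.2.2.2⟩

theorem generatesRightIdeal_rangeRestrict (φ : A →CP B) :
    GeneratesRightIdeal (rangeRestrict φ) := by
  intro S hS hmul hran
  -- The adjoint has to be carried along: `S` is only a right ideal, and `(x y)* = y* x*` lies in
  -- `S` because `y*` does.
  have hadj : ∀ x (hx : x ∈ NonUnitalStarAlgebra.adjoin ℂ (Set.range φ)),
      (⟨x, NonUnitalStarSubalgebra.le_topologicalClosure _ hx⟩ : rangeCStar φ) ∈ S ∧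
      star (⟨x, NonUnitalStarSubalgebra.le_topologicalClosure _ hx⟩ : rangeCStar φ) ∈ S := by
    intro x hx
    induction hx using NonUnitalStarAlgebra.adjoin_induction with
    | mem x hx =>
      obtain ⟨a, rfl⟩ := hx
      refine ⟨hran a, ?_⟩
      convert hran (star a) using 1
      exact Subtype.ext (map_star φ a).symm
    | add x y hx hy h h' =>
      exact ⟨S.add_mem h.1 h'.1, (congrArg (· ∈ S) (Subtype.ext (star_add x y))).mpr (S.add_mem h.2 h'.2)⟩
    | zero => exact ⟨S.zero_mem, (congrArg (· ∈ S) (Subtype.ext (star_zero B))).mpr S.zero_mem⟩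
    | mul x y hx hy h h' =>
      refine ⟨hmul _ h.1 ⟨y, NonUnitalStarSubalgebra.le_topologicalClosure _ hy⟩, ?_⟩
      exact (congrArg (· ∈ S) (Subtype.ext (star_mul x y))).mpr <| hmul _ h'.2 (star ⟨x, NonUnitalStarSubalgebra.le_topologicalClosure _ hx⟩)
    | smul r x hx h =>
      exact ⟨S.smul_mem r h.1, (congrArg (· ∈ S) (Subtype.ext (star_smul r x))).mpr (S.smul_mem (star r) h.2)⟩
    | star x hx h => exact ⟨h.2, (congrArg (· ∈ S) (Subtype.ext (star_star x))).mpr h.1⟩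
  refine eq_top_iff.mpr fun c _ => ?_
  rw [← SetLike.mem_coe, ← hS.closure_eq, Metric.mem_closure_iff]
  intro ε hε
  obtain ⟨x, hx, hd⟩ := Metric.mem_closure_iff.mp (show (c : B) ∈ closure _ from c.2) ε hε
  exact ⟨_, (hadj x hx).1, hd⟩

end OrderZeroMaps

/-! ### Nondegeneracy of the universal representation; positivity in the bidual -/

section UniversalRepresentation

variable {C : Type*} [NonUnitalCStarAlgebra C] [PartialOrder C] [StarOrderedRing C]

theorem norm_universalRep_le (c : C) : ‖universalRep C c‖ ≤ ‖c‖ :=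
  NonUnitalStarAlgHom.norm_apply_le (universalRep C) c

theorem continuous_universalRep : Continuous (universalRep C) :=
  AddMonoidHomClass.continuous_of_bound (universalRep C) 1 fun c => by
    simpa using norm_universalRep_le c

theorem continuous_toPreGNS (f : C →ₚ[ℂ] ℂ) : Continuous f.toPreGNS := by
  refine continuous_iff_continuousAt.mpr fun c => ?_
  rw [ContinuousAt, tendsto_iff_norm_sub_tendsto_zero]
  have hf : Continuous f := map_continuous f
  have h : Continuous fun x : C => √(f (star (x - c) * (x - c))).re := by fun_prop
  simpa [← map_sub, PositiveLinearMap.preGNS_norm_def] using h.tendsto c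

/-- For a vector `x` coming from `c`, `⟪η, u c⟫ = ⟪π(u*) η, x⟫ = 0`, and `u c → c` along an
approximate unit. Such vectors are dense. -/
theorem gns_eq_zero_of_forall {f : C →ₚ[ℂ] ℂ} {η : f.GNS}
    (h : ∀ c, f.gnsNonUnitalStarAlgHom c η = 0) : η = 0 := by
  have hd : Dense (Set.range ((↑) : f.PreGNS → f.GNS)) :=
    UniformSpace.Completion.denseRange_coe
  refine hd.eq_zero_of_inner_left ℂ ?_
  intro v hv
  obtain ⟨x, rfl⟩ := hv
  set c := f.ofPreGNS x with hc
  have hl := CStarAlgebra.increasingApproximateUnit C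
  have := hl.neBot
  have h1 : Tendsto (fun u => ⟪η, ((f.toPreGNS (u * c) : f.PreGNS) : f.GNS)⟫_ℂ)
      (CStarAlgebra.approximateUnit C) (𝓝 ⟪η, ((f.toPreGNS c : f.PreGNS) : f.GNS)⟫_ℂ) := by
    have hcont : Continuous fun b => ⟪η, ((f.toPreGNS b : f.PreGNS) : f.GNS)⟫_ℂ :=
      continuous_const.inner
        ((UniformSpace.Completion.continuous_coe _).comp (continuous_toPreGNS f))
    exact (hcont.tendsto c).comp (hl.tendsto_mul_right c)
  have h2 : ∀ u, ⟪η, ((f.toPreGNS (u * c) : f.PreGNS) : f.GNS)⟫_ℂ = 0 := fun u => by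
    have h3 : ((f.toPreGNS (u * c) : f.PreGNS) : f.GNS) =
        star (f.gnsNonUnitalStarAlgHom (star u)) ((x : f.PreGNS) : f.GNS) := by
      rw [← map_star, star_star, PositiveLinearMap.gnsNonUnitalStarAlgHom_apply_coe]
      rfl
    rw [h3, ContinuousLinearMap.star_eq_adjoint, ContinuousLinearMap.adjoint_inner_right, h,
      inner_zero_left]
  simp only [h2] at h1
  exact tendsto_nhds_unique h1 tendsto_const_nhds

/-- The universal representation is nondegenerate. -/
theorem eq_zero_of_forall_universalRep {η : UniversalSpace C}
    (h : ∀ c, universalRep C c η = 0) : η = 0 := by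
  apply lp.ext
  funext f
  refine gns_eq_zero_of_forall fun c => ?_
  exact congrArg (fun ξ : UniversalSpace C => ξ f) (h c)

/-- A closed subspace that contains the range of every `universalRep C c` is everything. -/
theorem submodule_eq_top_of_universalRep {S : Submodule ℂ (UniversalSpace C)}
    (hS : IsClosed (S : Set (UniversalSpace C))) (h : ∀ c ξ, universalRep C c ξ ∈ S) : S = ⊤ := by
  have : CompleteSpace S := hS.completeSpace_coe
  rw [← Submodule.orthogonal_eq_bot_iff, Submodule.eq_bot_iff]
  intro η hη
  refine eq_zero_of_forall_universalRep fun c => ?_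
  refine ext_inner_left ℂ fun ξ => ?_
  rw [inner_zero_right, ← star_star c, map_star, ContinuousLinearMap.star_eq_adjoint,
    ContinuousLinearMap.adjoint_inner_right]
  exact hη _ (h _ _)

variable (C) in
/-- The canonical embedding of `C` into `C**` as a `*`-homomorphism. -/
noncomputable def toBidualHom : C →⋆ₙₐ[ℂ] Bidual C where
  toFun := toBidual C
  map_smul' z c := Subtype.ext (map_smul (universalRep C) z c)
  map_zero' := Subtype.ext (map_zero (universalRep C))
  map_add' c d := Subtype.ext (map_add (universalRep C) c d)
  map_mul' c d := Subtype.ext (map_mul (universalRep C) c d)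
  map_star' c := Subtype.ext (map_star (universalRep C) c)

theorem coe_toBidualHom (c : C) :
    (toBidualHom C c : UniversalSpace C →L[ℂ] UniversalSpace C) = universalRep C c :=
  rfl

/-- A selfadjoint element of the bidual that annihilates `C` vanishes. -/
theorem bidual_eq_zero_of_mul {d : Bidual C} (hd : IsSelfAdjoint d)
    (h : ∀ c, d * toBidualHom C c = 0) : d = 0 := by
  refine Subtype.ext (ContinuousLinearMap.ext fun ξ => ?_)
  refine eq_zero_of_forall_universalRep fun c => ?_
  have h1 : toBidualHom C c * d = 0 := by
    have := congrArg star (h (star c))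
    rwa [star_mul, hd.star_eq, map_star, star_star, star_zero] at this
  exact congrArg (fun T : Bidual C => (T : UniversalSpace C →L[ℂ] UniversalSpace C) ξ) h1

/-- Positivity is tested on `⟪T ξ, ξ⟫`, which is continuous under strong limits. -/
theorem bidual_nonneg_of_tendsto {ι : Type*} {l : Filter ι} [l.NeBot] {T : ι → Bidual C}
    {T₀ : Bidual C} (hT : ∀ᶠ i in l, 0 ≤ T i)
    (h : ∀ ξ, Tendsto (fun i => (T i : UniversalSpace C →L[ℂ] UniversalSpace C) ξ) l
      (𝓝 ((T₀ : UniversalSpace C →L[ℂ] UniversalSpace C) ξ))) : 0 ≤ T₀ := by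
  change (0 : UniversalSpace C →L[ℂ] UniversalSpace C) ≤ T₀
  rw [ContinuousLinearMap.nonneg_iff_isPositive, ContinuousLinearMap.isPositive_iff_complex]
  intro ξ
  have h0 : 0 ≤ ⟪(T₀ : UniversalSpace C →L[ℂ] UniversalSpace C) ξ, ξ⟫_ℂ := by
    refine ge_of_tendsto ((h ξ).inner tendsto_const_nhds) ?_
    filter_upwards [hT] with i hi
    have hi' : (0 : UniversalSpace C →L[ℂ] UniversalSpace C) ≤ T i := hi
    exact ((ContinuousLinearMap.nonneg_iff_isPositive _).mp hi').inner_nonneg_left ξ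
  rw [Complex.nonneg_iff] at h0
  exact ⟨Complex.ext (by simp) (by simpa using h0.2), h0.1⟩

end UniversalRepresentation

/-! ### The strong limit and the extension to the unitization -/

section UnitizationExtension

/-- The element of `A` with `inr (x.compressRight u) = x * inr u`. -/
def Unitization.compressRight {A : Type*} [NonUnitalCStarAlgebra A]
    (x : Unitization ℂ A) (u : A) : A :=
  x.fst • u + x.snd * u

theorem Unitization.inr_compressRight {A : Type*} [NonUnitalCStarAlgebra A]
    (x : Unitization ℂ A) (u : A) :
    (x.compressRight u : Unitization ℂ A) = x * (u : Unitization ℂ A) := by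
  ext <;> simp [Unitization.compressRight]

variable {A C : Type*} [NonUnitalCStarAlgebra A] [PartialOrder A] [StarOrderedRing A]
  [NonUnitalCStarAlgebra C] [PartialOrder C] [StarOrderedRing C]

/-- `h` is the strong limit of `φ u` along every approximate unit of positive contractions. -/
def IsStrongLimit (φ : A →CP C) (h : Bidual C) : Prop :=
  ∀ l : Filter A, l.IsIncreasingApproximateUnit → ∀ ξ : UniversalSpace C,
    Tendsto (fun u => universalRep C (φ u) ξ) l
      (𝓝 ((h : UniversalSpace C →L[ℂ] UniversalSpace C) ξ))

theorem eventually_norm_universalRep_le {φ : A →CP C} (hφ : IsContractive φ) {l : Filter A}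
    (hl : l.IsIncreasingApproximateUnit) : ∀ᶠ u in l, ‖universalRep C (φ u)‖ ≤ 1 := by
  filter_upwards [hl.eventually_norm] with u hu
  exact (norm_universalRep_le _).trans ((hφ u).trans hu)

/-- On vectors `π(c) ξ` this is the norm convergence of `φ(u) c`; these vectors span a dense
subspace. -/
theorem IsOrderZero.exists_tendsto_universalRep {φ : A →CP C} (hφ : IsContractive φ)
    (hφ₀ : IsOrderZero φ) (hg : GeneratesRightIdeal φ) {l : Filter A}
    (hl : l.IsIncreasingApproximateUnit) (ξ : UniversalSpace C) :
    ∃ η, Tendsto (fun u => universalRep C (φ u) ξ) l (𝓝 η) := by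
  have := hl.neBot
  have h : convergenceSubmodule (fun u => universalRep C (φ u)) l = ⊤ := by
    refine submodule_eq_top_of_universalRep
      (isClosed_convergenceSubmodule (eventually_norm_universalRep_le hφ hl)) fun c ξ => ?_
    obtain ⟨y, hy⟩ := hφ₀.exists_tendsto_mul_of_generates hφ hg hl c
    refine ⟨universalRep C y ξ, ?_⟩
    have h1 : Continuous fun c => universalRep C c ξ :=
      (ContinuousLinearMap.apply ℂ _ ξ).continuous.comp continuous_universalRep
    simpa [Function.comp_def] using (h1.tendsto y).comp hy
  exact (h ▸ Submodule.mem_top : ξ ∈ convergenceSubmodule (fun u => universalRep C (φ u)) l)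

theorem IsOrderZero.exists_isStrongLimit {φ : A →CP C} (hφ : IsContractive φ)
    (hφ₀ : IsOrderZero φ) (hg : GeneratesRightIdeal φ) : ∃ h : Bidual C, IsStrongLimit φ h := by
  have hl₀ := CStarAlgebra.increasingApproximateUnit A
  have := hl₀.neBot
  obtain ⟨T, hT⟩ := exists_clm_of_tendsto (eventually_norm_universalRep_le hφ hl₀)
    (hφ₀.exists_tendsto_universalRep hφ hg hl₀)
  have hcomm : ∀ S : UniversalSpace C →L[ℂ] UniversalSpace C,
      (∀ c, universalRep C c * S = S * universalRep C c) → S * T = T * S := by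
    intro S hS
    ext1 ξ
    refine tendsto_nhds_unique ((S.continuous.tendsto _).comp (hT ξ)) ?_
    refine (hT (S ξ)).congr fun u => ?_
    exact congrArg (fun R : UniversalSpace C →L[ℂ] UniversalSpace C => R ξ) (hS (φ u))
  have hmem : T ∈ (envelopingVonNeumannAlgebra C).toStarSubalgebra := by
    -- Membership in this centralizer asks for commutation with both `S` and `star S`.
    refine (StarSubalgebra.mem_centralizer_iff ℂ).mpr fun S hS => ?_
    have hS' := fun R hR => (StarSubalgebra.mem_centralizer_iff ℂ).mp hS R hR
    refine ⟨hcomm S fun c => (hS' _ ⟨c, rfl⟩).1, hcomm (star S) fun c => ?_⟩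
    have := congrArg star (hS' _ ⟨star c, rfl⟩).1
    rw [star_mul, star_mul, map_star, star_star] at this
    exact this.symm
  refine ⟨⟨T, hmem⟩, fun l hl ξ => ?_⟩
  -- Convergence along the join with the fixed approximate unit identifies the limit along `l` with
  -- `T ξ`.
  obtain ⟨η, hη⟩ := hφ₀.exists_tendsto_universalRep hφ hg (hl.sup hl₀) ξ
  have hη' : η = T ξ := tendsto_nhds_unique (hη.mono_left le_sup_right) (hT ξ)
  exact hη' ▸ hη.mono_left le_sup_left

/-- The linear map `z + a ↦ z h + φ a` from the unitization of `A` to `C**`. -/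
noncomputable def unitizationMap (φ : A →CP C) (h : Bidual C) :
    Unitization ℂ A →ₗ[ℂ] Bidual C where
  toFun x := x.fst • h + toBidualHom C (φ x.snd)
  map_add' x y := by
    simp only [Unitization.fst_add, Unitization.snd_add, add_smul, map_add]
    abel
  map_smul' z x := by
    simp only [Unitization.fst_smul, Unitization.snd_smul, map_smul, smul_add, smul_smul,
      smul_eq_mul, RingHom.id_apply]

theorem unitizationMap_apply (φ : A →CP C) (h : Bidual C) (x : Unitization ℂ A) :
    unitizationMap φ h x = x.fst • h + toBidualHom C (φ x.snd) :=
  rfl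

theorem unitizationMap_inr (φ : A →CP C) (h : Bidual C) (a : A) :
    unitizationMap φ h (a : Unitization ℂ A) = toBidualHom C (φ a) := by
  simp [unitizationMap_apply]

theorem unitizationMap_one (φ : A →CP C) (h : Bidual C) : unitizationMap φ h 1 = h := by
  simp [unitizationMap_apply]

/-- Common form of the approximations of `x` from within `A`: `U` is `u` or `u²`, and `G` collects
the terms that converge in norm to `x.snd`. -/
theorem tendsto_unitizationMap {φ : A →CP C} (hφ : IsContractive φ) {h : Bidual C}
    {ι : Type*} {l : Filter ι} {U G : ι → A} (x : Unitization ℂ A) {ξ : UniversalSpace C}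
    (hU : Tendsto (fun i => universalRep C (φ (U i)) ξ) l
      (𝓝 ((h : UniversalSpace C →L[ℂ] UniversalSpace C) ξ)))
    (hG : Tendsto G l (𝓝 x.snd)) :
    Tendsto (fun i => universalRep C (φ (x.fst • U i + G i)) ξ) l
      (𝓝 ((unitizationMap φ h x : UniversalSpace C →L[ℂ] UniversalSpace C) ξ)) := by
  have h1 : Continuous fun a => universalRep C (φ a) ξ :=
    (ContinuousLinearMap.apply ℂ _ ξ).continuous.comp
      (continuous_universalRep.comp hφ.continuous)
  have h2 := (hU.const_smul x.fst).add ((h1.tendsto _).comp hG)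
  simpa [unitizationMap_apply, coe_toBidualHom, Function.comp_def] using h2

variable {φ : A →CP C} {h : Bidual C}

theorem IsStrongLimit.nonneg (hh : IsStrongLimit φ h) : 0 ≤ h := by
  have hl := CStarAlgebra.increasingApproximateUnit A
  have := hl.neBot
  refine bidual_nonneg_of_tendsto (T := fun u => toBidualHom C (φ u)) ?_ (hh _ hl)
  filter_upwards [hl.eventually_nonneg] with u hu
  exact map_nonneg (toBidualHom C) (map_nonneg φ hu)

theorem IsStrongLimit.unitizationMap_star (hh : IsStrongLimit φ h) (x : Unitization ℂ A) :
    unitizationMap φ h (star x) = star (unitizationMap φ h x) := by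
  simp only [unitizationMap_apply, Unitization.fst_star, Unitization.snd_star, star_add,
    star_smul, (IsSelfAdjoint.of_nonneg hh.nonneg).star_eq, map_star]

/-- `x u` lies in `A` with `‖x u‖ ≤ ‖x‖`, and operator norm bounds survive strong limits. -/
theorem IsStrongLimit.norm_unitizationMap_le (hh : IsStrongLimit φ h) (hφ : IsContractive φ)
    (x : Unitization ℂ A) : ‖unitizationMap φ h x‖ ≤ ‖x‖ := by
  have hl := CStarAlgebra.increasingApproximateUnit A
  have := hl.neBot
  refine ContinuousLinearMap.opNorm_le_bound _ (norm_nonneg x) fun ξ => ?_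
  refine le_of_tendsto
    (tendsto_unitizationMap hφ x (hh _ hl ξ) (hl.tendsto_mul_left x.snd)).norm ?_
  filter_upwards [hl.eventually_norm] with u hu
  refine ContinuousLinearMap.le_of_opNorm_le _ ((norm_universalRep_le _).trans ?_) ξ
  refine (hφ _).trans ?_
  rw [← Unitization.norm_inr (𝕜 := ℂ)]
  refine (congrArg norm (x.inr_compressRight u)).trans_le ((norm_mul_le _ _).trans ?_)
  rw [Unitization.norm_inr]
  exact mul_le_of_le_one_right (norm_nonneg _) hu

/-- If `M = S* S`, the matrix with entries `u Mᵢⱼ u` is `(S u)* (S u)` and has entries in `A`, so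
`φ` maps it to a positive matrix. The conjugated sums then converge strongly. -/
theorem IsStrongLimit.map_cstarMatrix_nonneg (hh : IsStrongLimit φ h) (hφ : IsContractive φ)
    (k : ℕ) (M : CStarMatrix (Fin k) (Fin k) (Unitization ℂ A)) (hM : 0 ≤ M) :
    0 ≤ M.map (unitizationMap φ h) := by
  have hl := CStarAlgebra.increasingApproximateUnit A
  have := hl.neBot
  refine CStarMatrix.nonneg_of_sum_conj_nonneg ?_ fun v => ?_
  · refine CStarMatrix.ext fun i j => ?_
    rw [CStarMatrix.star_apply, CStarMatrix.map_apply, CStarMatrix.map_apply,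
      ← hh.unitizationMap_star, CStarMatrix.star_apply_of_isSelfAdjoint (.of_nonneg hM)]
  obtain ⟨S, hS⟩ := exists_eq_star_mul_self hM
  let X : A → CStarMatrix (Fin k) (Fin k) A := fun u =>
    CStarMatrix.ofMatrix fun i j => (S i j).compressRight u
  have hX : ∀ u, IsSelfAdjoint u → ∀ i j, (star (X u) * X u) i j =
      (M i j).fst • (u * u) + u * (M i j).snd * u := by
    intro u hu i j
    refine Unitization.inr_injective (R := ℂ) ?_
    have h1 : ((((M i j).fst • (u * u) + u * (M i j).snd * u : A)) : Unitization ℂ A) =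
        (u : Unitization ℂ A) * M i j * (u : Unitization ℂ A) := by
      ext <;> simp [add_mul, smul_mul_assoc]
    have h2 : ∀ k, ((star (X u k i) * X u k j : A) : Unitization ℂ A) =
        (u : Unitization ℂ A) * (star (S k i) * S k j) * (u : Unitization ℂ A) := fun k => by
      rw [Unitization.inr_mul, Unitization.inr_star]
      change star (((S k i).compressRight u : A) : Unitization ℂ A) *
        (((S k j).compressRight u : A) : Unitization ℂ A) = _
      rw [Unitization.inr_compressRight, Unitization.inr_compressRight, star_mul,
        ← Unitization.inr_star, hu.star_eq]
      simp only [mul_assoc]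
    rw [h1, hS, CStarMatrix.mul_apply, CStarMatrix.mul_apply, Finset.mul_sum, Finset.sum_mul]
    simp only [CStarMatrix.star_apply]
    rw [← Finset.sum_congr rfl fun k _ => h2 k]
    exact map_sum (Unitization.inrNonUnitalAlgHom ℂ A) _ _
  refine bidual_nonneg_of_tendsto (l := CStarAlgebra.approximateUnit A)
    (T := fun u => ∑ i, ∑ j,
      star (v i) * toBidualHom C (φ ((M i j).fst • (u * u) + u * (M i j).snd * u)) * v j) ?_ ?_
  · filter_upwards [hl.eventually_nonneg] with u hu
    have h1 : 0 ≤ (star (X u) * X u).map φ := φ.map_cstarMatrix_nonneg _ (star_mul_self_nonneg _)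
    have h2 : 0 ≤ ((star (X u) * X u).map φ).map (toBidualHom C) :=
      map_nonneg (CStarMatrix.mapₙₐ (toBidualHom C)) h1
    have h3 := CStarMatrix.sum_conj_nonneg h2 v
    simpa only [CStarMatrix.map_apply, hX u (.of_nonneg hu)] using h3
  · intro ξ
    simp only [AddSubmonoidClass.coe_finsetSum, sum_apply]
    refine tendsto_finsetSum _ fun i _ => tendsto_finsetSum _ fun j _ => ?_
    refine (ContinuousLinearMap.continuous
      ((star (v i) : Bidual C) : UniversalSpace C →L[ℂ] UniversalSpace C)).tendsto _ |>.comp ?_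
    refine tendsto_unitizationMap hφ (M i j) ?_
      (hl.tendsto_mul_mul' (hl.tendsto_mul_right (M i j).snd))
    exact tendsto_map'_iff.mp (hh _ hl.map_mul_self _)

/-- With `y = c* c`, `a y = 0` forces `c a = 0`. Hence `c* u c` is a positive element of `A`
orthogonal to `a`, and its images under `φ` converge strongly to the image of `y`. -/
theorem IsStrongLimit.unitizationMap_mul_eq_zero (hh : IsStrongLimit φ h) (hφ : IsContractive φ)
    (hφ₀ : IsOrderZero φ) {a : A} {y : Unitization ℂ A} (ha : 0 ≤ a) (hy : 0 ≤ y)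
    (hay : (a : Unitization ℂ A) * y = 0) :
    unitizationMap φ h a * unitizationMap φ h y = 0 := by
  have hl := CStarAlgebra.increasingApproximateUnit A
  have := hl.neBot
  obtain ⟨c, hc⟩ := exists_eq_star_mul_self hy
  have has : star a = a := (IsSelfAdjoint.of_nonneg ha).star_eq
  have has' : star (a : Unitization ℂ A) = a := by rw [← Unitization.inr_star, has]
  have hca : c * (a : Unitization ℂ A) = 0 := by
    refine (CStarRing.star_mul_self_eq_zero_iff _).mp ?_
    rw [star_mul, has', mul_assoc, ← mul_assoc (star c), ← hc, ← mul_assoc, hay, zero_mul]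
  -- This is `c* u c` expanded. The coefficient of `u` is `y.fst`, the squared modulus of `c.fst`;
  -- the other terms converge in norm.
  let w : A → A := fun u => y.fst • u + (star c.fst • (u * c.snd) + c.fst • (star c.snd * u) +
    star c.snd * u * c.snd)
  have hw : ∀ u, (w u : Unitization ℂ A) = star c * (u : Unitization ℂ A) * c := by
    intro u
    ext
    · simp [w]
    · simp [w, hc, add_mul, smul_mul_assoc, smul_smul, smul_add]
      rw [mul_comm]
      abel
  have hwlim : Tendsto (fun u => star c.fst • (u * c.snd) + c.fst • (star c.snd * u) +
      star c.snd * u * c.snd) (CStarAlgebra.approximateUnit A) (𝓝 y.snd) := by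
    have hys : y.snd = star c.fst • c.snd + c.fst • star c.snd + star c.snd * c.snd := by
      simp [hc]
    rw [hys]
    exact (((hl.tendsto_mul_right _).const_smul _).add
      ((hl.tendsto_mul_left _).const_smul _)).add ((hl.tendsto_mul_left _).mul_const _)
  have horth : ∀ u, 0 ≤ u → φ a * φ (w u) = 0 := by
    intro u hu
    have hwn : 0 ≤ w u := by
      rw [← Unitization.inr_nonneg_iff, hw]
      exact star_left_conjugate_nonneg (Unitization.inr_nonneg_iff.mpr hu) c
    have hws : star (w u) = w u := (IsSelfAdjoint.of_nonneg hwn).star_eq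
    have h1 : w u * a = 0 := Unitization.inr_injective (R := ℂ) <| by
      rw [Unitization.inr_mul, hw, mul_assoc, hca, mul_zero, Unitization.inr_zero]
    have h2 : a * w u = 0 := by
      have := congrArg star h1
      rwa [star_mul, has, hws, star_zero] at this
    exact (hφ₀ a (w u) ha hwn ⟨h2, h1, has.symm ▸ h2, hws.symm ▸ h2⟩).1
  refine Subtype.ext (ContinuousLinearMap.ext fun ξ => ?_)
  have hlim := ((universalRep C (φ a)).continuous.tendsto _).comp
    (tendsto_unitizationMap hφ y (hh _ hl ξ) hwlim)
  rw [unitizationMap_inr]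
  refine tendsto_nhds_unique hlim (tendsto_const_nhds.congr' ?_)
  filter_upwards [hl.eventually_nonneg] with u hu
  have h3 := congrArg (universalRep C) (horth u hu)
  rw [map_mul, map_zero] at h3
  exact (congrArg (fun R : UniversalSpace C →L[ℂ] UniversalSpace C => R ξ) h3).symm

/-- The completely positive extension of `φ` to the unitization with `1 ↦ h`. -/
noncomputable def IsStrongLimit.extension (hh : IsStrongLimit φ h) (hφ : IsContractive φ) :
    Unitization ℂ A →CP Bidual C where
  __ := unitizationMap φ h
  map_cstarMatrix_nonneg' := hh.map_cstarMatrix_nonneg hφ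

theorem IsStrongLimit.extension_apply (hh : IsStrongLimit φ h) (hφ : IsContractive φ)
    (x : Unitization ℂ A) : hh.extension hφ x = unitizationMap φ h x :=
  rfl

/-- The scalar part is multiplicative, so of two orthogonal elements at least one lies in `A`.
Taking adjoints exchanges the two cases. -/
theorem IsStrongLimit.isOrderZero_extension (hh : IsStrongLimit φ h) (hφ : IsContractive φ)
    (hφ₀ : IsOrderZero φ) : IsOrderZero (hh.extension hφ) := by
  intro x y hx hy hxy
  have hxs : star (hh.extension hφ x) = hh.extension hφ x := by
    rw [← map_star, (IsSelfAdjoint.of_nonneg hx).star_eq]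
  have hys : star (hh.extension hφ y) = hh.extension hφ y := by
    rw [← map_star, (IsSelfAdjoint.of_nonneg hy).star_eq]
  have key : ∀ x y : Unitization ℂ A, 0 ≤ x → 0 ≤ y → x * y = 0 → x.fst = 0 →
      hh.extension hφ x * hh.extension hφ y = 0 := by
    intro x y hx hy hxy h0
    have hxa : x = (x.snd : Unitization ℂ A) := by ext <;> simp [h0]
    rw [hxa] at hx hxy ⊢
    exact hh.unitizationMap_mul_eq_zero hφ hφ₀ (Unitization.inr_nonneg_iff.mp hx) hy hxy
  have hmul : hh.extension hφ x * hh.extension hφ y = 0 := by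
    have h0 : x.fst * y.fst = 0 := by
      rw [← Unitization.fst_mul, hxy.1, Unitization.fst_zero]
    rcases mul_eq_zero.mp h0 with h0 | h0
    · exact key x y hx hy hxy.1 h0
    · have := congrArg star (key y x hy hx hxy.2.1 h0)
      rwa [star_mul, hxs, hys, star_zero] at this
  have hmul' : hh.extension hφ y * hh.extension hφ x = 0 := by
    have := congrArg star hmul
    rwa [star_mul, hxs, hys, star_zero] at this
  exact ⟨hmul, hmul', hxs.symm ▸ hmul, hys.symm ▸ hmul⟩

/-- An element annihilates the image of a `*`-homomorphism if it annihilates the images of all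
`φ f` for which `f` is positive with a local unit. -/
theorem GeneratesRightIdeal.mul_eq_zero {D : Type*} [NonUnitalCStarAlgebra D]
    (hg : GeneratesRightIdeal φ) (hφ : IsContractive φ) (θ : C →⋆ₙₐ[ℂ] D) (d : D)
    (h : ∀ f e : A, 0 ≤ f → IsSelfAdjoint e → e * f = f → d * θ (φ f) = 0) (c : C) :
    d * θ c = 0 := by
  have hθ : Continuous θ := AddMonoidHomClass.continuous_of_bound θ 1 fun c => by
    simpa using NonUnitalStarAlgHom.norm_apply_le θ c
  let S : Submodule ℂ C :=
    { carrier := {c | d * θ c = 0}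
      add_mem' := fun {x y} hx hy => by
        rw [Set.mem_ofPred_eq] at hx hy ⊢
        rw [map_add, mul_add, hx, hy, add_zero]
      zero_mem' := by simp
      smul_mem' := fun z x hx => by
        rw [Set.mem_ofPred_eq] at hx ⊢
        rw [map_smul, mul_smul_comm, hx, smul_zero] }
  have hS : ∀ x, x ∈ S ↔ d * θ x = 0 := fun _ => Iff.rfl
  have hSc : IsClosed (S : Set C) :=
    isClosed_eq (continuous_const.mul hθ) continuous_const
  have hA : S.comap φ.toLinearMap = ⊤ :=
    submodule_eq_top_of_localUnit (hSc.preimage hφ.continuous) h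
  have hT : S = ⊤ := by
    refine hg S hSc (fun x hx y => ?_) fun a => ?_
    · rw [hS] at hx ⊢
      rw [map_mul, ← mul_assoc, hx, zero_mul]
    · exact (hA ▸ Submodule.mem_top : a ∈ S.comap φ.toLinearMap)
  exact (hS c).mp (hT ▸ Submodule.mem_top)

/-- Order zero maps on the unitization that agree with `φ` on `A` agree at the unit. -/
theorem IsOrderZero.map_one_unique (hg : GeneratesRightIdeal φ) (hφ : IsContractive φ)
    {Φ Ψ : Unitization ℂ A →CP Bidual C} (hΦ : IsOrderZero Φ) (hΨ : IsOrderZero Ψ)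
    (hΦφ : ∀ a : A, Φ (a : Unitization ℂ A) = toBidualHom C (φ a))
    (hΨφ : ∀ a : A, Ψ (a : Unitization ℂ A) = toBidualHom C (φ a)) : Ψ 1 = Φ 1 := by
  have key : ∀ Θ : Unitization ℂ A →CP Bidual C, IsOrderZero Θ →
      (∀ a : A, Θ (a : Unitization ℂ A) = toBidualHom C (φ a)) →
      ∀ f e : A, 0 ≤ f → IsSelfAdjoint e → e * f = f →
        Θ 1 * toBidualHom C (φ f) =
          toBidualHom C (φ (e + e - e * e)) * toBidualHom C (φ f) := by
    intro Θ hΘ hΘφ f e hf he hef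
    -- For `u = 1` the replacement `eu + ue - eue` is `2e - e²`, which lies in `A`, where `Θ` is
    -- given by `φ`.
    have h1 := hΘ.mul_eq_of_localUnit (u := 1) (f := (f : Unitization ℂ A))
      (e := (e : Unitization ℂ A)) zero_le_one (Unitization.inr_nonneg_iff.mpr hf)
      (by rw [IsSelfAdjoint, ← Unitization.inr_star, he.star_eq])
      (by rw [← Unitization.inr_mul, hef])
    simp only [mul_one, one_mul] at h1
    rwa [← Unitization.inr_mul, ← Unitization.inr_add, ← Unitization.inr_sub, hΘφ, hΘφ] at h1
  have hs : ∀ Θ : Unitization ℂ A →CP Bidual C, IsSelfAdjoint (Θ 1) := fun Θ => by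
    rw [IsSelfAdjoint, ← map_star, star_one]
  rw [← sub_eq_zero]
  -- The difference of the two values at one is selfadjoint and annihilates each `φ(f)` with a local
  -- unit, hence all of `C`.
  refine bidual_eq_zero_of_mul ((hs Ψ).sub (hs Φ))
    (hg.mul_eq_zero hφ (toBidualHom C) _ fun f e hf he hef => ?_)
  rw [sub_mul, key Ψ hΨ hΨφ f e hf he hef, key Φ hΦ hΦφ f e hf he hef, sub_self]

/-- Unitization of an order zero map whose range generates its codomain. -/
theorem IsOrderZero.exists_unique_unitization (hg : GeneratesRightIdeal φ) (hφ : IsContractive φ)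
    (hφ₀ : IsOrderZero φ) :
    ∃ Φ : Unitization ℂ A →CP Bidual C,
      (IsContractive Φ ∧ IsOrderZero Φ ∧
        ∀ a : A, Φ (a : Unitization ℂ A) = toBidualHom C (φ a)) ∧
      (∀ Ψ : Unitization ℂ A →CP Bidual C, IsOrderZero Ψ →
        (∀ a : A, Ψ (a : Unitization ℂ A) = toBidualHom C (φ a)) → Ψ = Φ) ∧
      IsStrongLimit φ (Φ 1) := by
  obtain ⟨h, hh⟩ := hφ₀.exists_isStrongLimit hφ hg
  have hΦ₀ := hh.isOrderZero_extension hφ hφ₀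
  have hΦφ : ∀ a : A, hh.extension hφ (a : Unitization ℂ A) = toBidualHom C (φ a) :=
    unitizationMap_inr φ h
  refine ⟨hh.extension hφ, ⟨hh.norm_unitizationMap_le hφ, hΦ₀, hΦφ⟩, fun Ψ hΨ₀ hΨφ => ?_, ?_⟩
  · have h1 : Ψ 1 = hh.extension hφ 1 := IsOrderZero.map_one_unique hg hφ hΦ₀ hΨ₀ hΦφ hΨφ
    refine DFunLike.ext _ _ fun x => ?_
    have hx : x = x.fst • (1 : Unitization ℂ A) + (x.snd : Unitization ℂ A) := by
      ext <;> simp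
    rw [hx, map_add, map_add, map_smul, map_smul, h1, hΨφ, hΦφ]
  · rwa [hh.extension_apply, unitizationMap_one]

end UnitizationExtension

theorem proposition2p2 {A B : Type*}
    [NonUnitalCStarAlgebra A] [PartialOrder A] [StarOrderedRing A]
    [NonUnitalCStarAlgebra B] [PartialOrder B] [StarOrderedRing B]
    (hA : ¬ ∃ e : A, ∀ a : A, e * a = a ∧ a * e = a)
    (φ : A →CP B) (hφ : IsContractive φ) (hφ₀ : IsOrderZero φ) :
    ∃ Φ : Unitization ℂ A →CP Bidual (rangeCStar φ),
      IsOrderZeroExtension φ Φ ∧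
      (∀ Ψ : Unitization ℂ A →CP Bidual (rangeCStar φ), IsOrderZeroExtension φ Ψ → Ψ = Φ) ∧
      -- `Φ(1)` is the strong limit of `φ(u)` along every approximate unit of positive contractions
      ∀ l : Filter A, l.IsIncreasingApproximateUnit →
        ∀ ξ : UniversalSpace (rangeCStar φ),
          Filter.Tendsto
            (fun u : A => universalRep (rangeCStar φ) ⟨φ u, map_mem_rangeCStar φ u⟩ ξ) l
            (𝓝 ((Φ 1 : UniversalSpace (rangeCStar φ) →L[ℂ] UniversalSpace (rangeCStar φ)) ξ)) := by
  exact (hφ₀.rangeRestrict.exists_unique_unitization (generatesRightIdeal_rangeRestrict φ)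
    hφ.rangeRestrict).imp fun Φ h =>
      ⟨⟨h.1.1, h.1.2.1, h.1.2.2⟩, fun Ψ hΨ => h.2.1 Ψ hΨ.orderZero hΨ.extends_map, h.2.2⟩
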